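/- Let $(\Omega,\mathcal F,\mu)$ be a probability space and let $T:\Omega\to\Omega$ be a bijective, bi-measurable, measure preserving map. For $h:\Omega\to\mathbb R$ write $Uh:=h\circ T$ and $S_n(h):=\sum_{j=0}^{n-1}h\circ T^j$, and let $I$ be the identity operator. Let $1<p<r<2$ and let $\mathcal M$ be a sub-$\sigma$-algebra of $\mathcal F$ such that $T\mathcal M\subset\mathcal M$ (that is, $T(A)\in\mathcal M$ for every $A\in\mathcal M$). Assume that $f:\Omega\to\mathbb R$ is an $\mathcal M$-measurable element of $\mathbb L^r(\mu)$ such that the following two conditions hold: - the sequence $(\mathbb E[S_n(f)\mid\mathcal M])_{n\ge1}$ converges in $\mathbb L^{\max\{1,(p-1)r/(r-1)\}}(\mu)$; - the sequence $((I-U)\,\mathbb E[S_n(f)\mid\mathcal M])_{n\ge1}$ converges in $\mathbb L^r(\mu)$. Then for every $\varepsilon>0$ and every $\alpha\in[1/p,1]$, $$\sum_{n=1}^{+\infty}n^{\alpha p-2}\,\mu\Big\{\max_{1\le k\le n}|S_k(f)|\ge\varepsilon n^\alpha\Big\}<+\infty .$$ -/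

import Mathlib

open MeasureTheory Filter Topology
open scoped ENNReal

/-- A sequence of real functions converges in `𝕃^q(μ)`: its terms belong to `𝕃^q(μ)` and, for some
`g` in `𝕃^q(μ)`, the `𝕃^q(μ)`-distance from the terms to `g` tends to `0`. -/
def ConvergesInLp {Ω : Type*} {mΩ : MeasurableSpace Ω} (u : ℕ → Ω → ℝ) (q : ℝ≥0∞)
    (μ : Measure Ω) : Prop :=
  (∀ n, MemLp (u n) q μ) ∧
    ∃ g : Ω → ℝ, MemLp g q μ ∧ Tendsto (fun n => eLpNorm (u n - g) q μ) atTop (𝓝 0)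

/-- The maximum over `1 ≤ k ≤ n` of `|S_k(f)(ω)|`, where
`S_k(f) = ∑_{0 ≤ j < k} f ∘ T^j = birkhoffSum T f k` and `n ≥ 1`. -/
noncomputable def maxAbsPartialSum {Ω : Type*} (T : Ω → Ω) (f : Ω → ℝ) (n : ℕ+) (ω : Ω) : ℝ :=
  (Finset.Icc 1 (n : ℕ)).sup' (Finset.nonempty_Icc.2 n.pos)
    (fun k => |birkhoffSum T f k ω|)

/-!
Let `g` be the `𝕃^1`-limit of `E[S_n(f) | M]`, chosen `M`-measurable, and put
`d = f - (g - g ∘ T)`. Then `d` is `T⁻¹ M`-measurable, belongs to `𝕃^r` by the second convergence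
hypothesis, and integrates to zero over every set of `M`, so that `d ∘ T ^ k` is a martingale
difference sequence for the filtration `T⁻ᵏ M`; moreover `S_n(f) = S_n(d) + g - g ∘ T ^ n`
(`exists_transfer_function`, `birkhoffSum_eq_add_coboundary`).

For the martingale part, Doob's maximal inequality for `|S_n(d)| ^ r` and the von Bahr–Esseen
inequality bound the probability of a maximum at least `c * n ^ α` by a multiple of
`n ^ (1 - α * r)`, and `r > p` makes the series converge
(`tsum_rpow_mul_measure_exists_birkhoffSum_ge_lt_top`).

For the coboundary part `g` is only known to have a moment of order `q = (p - 1) * r / (r - 1) < p`,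
which is not enough by itself, but the increments `h = g - g ∘ T` are in `𝕃^r`. With
`θ = (p - 1) / (r - 1) = q / r`, the orbit segment `0, …, n` is cut into blocks of length
`b ≈ n ^ (α * (1 - θ))`. On a block, `|g|` exceeds its value at the first point by at most the sum
of the `b` increments, so only `n / b` values of `g` enter. The sum of the increments is handled by
truncating `h` at a level of order `n ^ (α * θ)`. The two resulting series of tails are, up to
constants, the moments `E|g| ^ q` and `E|h| ^ r`
(`tsum_rpow_mul_measure_exists_orbit_ge_lt_top`).
-/

/-! ### Elementary inequalities -/

lemma abs_mul_abs_rpow_sub_two {r : ℝ} (hr : 1 < r) (a : ℝ) :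
    |a * |a| ^ (r - 2)| = |a| ^ (r - 1) := by
  rcases eq_or_ne a 0 with rfl | ha
  · simp [Real.zero_rpow (by linarith : r - 1 ≠ 0)]
  · have h := abs_pos.2 ha
    rw [abs_mul, abs_of_nonneg (Real.rpow_nonneg h.le _)]
    nth_rewrite 1 [← Real.rpow_one |a|]
    rw [← Real.rpow_add h]
    congr 1; ring

lemma abs_rpow_mul_abs_le {r : ℝ} (hr : 1 < r) (a b : ℝ) :
    |a| ^ (r - 1) * |b| ≤ |a| ^ r + |b| ^ r := by
  have key : ∀ {x : ℝ}, 0 ≤ x → x ^ (r - 1) * x = x ^ r := fun {x} hx => by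
    nth_rewrite 2 [← Real.rpow_one x]
    rw [← Real.rpow_add' hx (by linarith)]
    congr 1; ring
  have ha := Real.rpow_nonneg (abs_nonneg a) r
  have hb := Real.rpow_nonneg (abs_nonneg b) r
  rcases le_total |a| |b| with h | h
  · have := mul_le_mul_of_nonneg_right
      (Real.rpow_le_rpow (abs_nonneg a) h (by linarith : 0 ≤ r - 1)) (abs_nonneg b)
    rw [key (abs_nonneg b)] at this
    linarith
  · have := mul_le_mul_of_nonneg_left h (Real.rpow_nonneg (abs_nonneg a) (r - 1))
    rw [key (abs_nonneg a)] at this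
    linarith

/-- Homogeneity reduces a comparison of `|a + b| ^ r` with its expansion at `a` to the case
`a = 1`. -/
lemma abs_rpow_scale {r : ℝ} {a : ℝ} (ha : a ≠ 0) (b : ℝ) :
    |a + b| ^ r = |a| ^ r * |1 + b / a| ^ r ∧
      r * (a * |a| ^ (r - 2)) * b = |a| ^ r * (r * (b / a)) := by
  have h := abs_pos.2 ha
  constructor
  · rw [← Real.mul_rpow h.le (abs_nonneg _), ← abs_mul]
    congr 2; field_simp
  · have : |a| ^ r = |a| ^ (r - 2) * a ^ 2 := by
      rw [← sq_abs, ← Real.rpow_natCast, ← Real.rpow_add h]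
      congr 1; norm_num
    rw [this]; field_simp

/-- The tangent inequality for the convex function `|·| ^ r`. -/
lemma abs_rpow_add_ge {r : ℝ} (hr : 1 < r) (a b : ℝ) :
    |a| ^ r + r * (a * |a| ^ (r - 2)) * b ≤ |a + b| ^ r := by
  rcases eq_or_ne a 0 with rfl | ha
  · simp [Real.zero_rpow (by linarith : r ≠ 0), Real.rpow_nonneg]
  obtain ⟨h1, h2⟩ := abs_rpow_scale (r := r) ha b
  rw [h1, h2]
  have h : 1 + r * (b / a) ≤ |1 + b / a| ^ r := by
    rcases le_total (-1) (b / a) with ht | ht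
    · rw [abs_of_nonneg (by linarith)]
      exact one_add_mul_self_le_rpow_one_add ht hr.le
    · have : 0 ≤ |1 + b / a| ^ r := Real.rpow_nonneg (abs_nonneg _) _
      nlinarith
  have := mul_le_mul_of_nonneg_left h (Real.rpow_nonneg (abs_nonneg a) r)
  linarith

/-- The pointwise form of the von Bahr–Esseen inequality. -/
lemma abs_rpow_add_le {r : ℝ} (hr : 1 < r) (hr2 : r < 2) (a b : ℝ) :
    |a + b| ^ r ≤ |a| ^ r + r * (a * |a| ^ (r - 2)) * b + 6 * |b| ^ r := by
  have hA := Real.rpow_nonneg (abs_nonneg a) r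
  have hB := Real.rpow_nonneg (abs_nonneg b) r
  rcases eq_or_ne a 0 with rfl | ha
  · simp [Real.zero_rpow (by linarith : r ≠ 0)]; linarith
  have hpos := abs_pos.2 ha
  rcases le_total |b| |a| with hab | hab
  · obtain ⟨h1, h2⟩ := abs_rpow_scale (r := r) ha b
    have hb : |b| ^ r = |a| ^ r * |b / a| ^ r := by
      rw [← Real.mul_rpow hpos.le (abs_nonneg _), ← abs_mul]
      congr 2; field_simp
    have ht : |b / a| ≤ 1 := by
      rw [abs_div]; exact (div_le_one hpos).2 hab
    generalize b / a = t at *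
    have ht' := abs_le.1 ht
    have h : |1 + t| ^ r ≤ 1 + r * t + |t| ^ r := by
      rw [abs_of_nonneg (by linarith)]
      -- Bernoulli's inequality for the exponent `r / 2 ≤ 1`, squared
      have e : (1 + t) ^ r = ((1 + t) ^ (r / 2)) ^ 2 := by
        rw [← Real.rpow_natCast, ← Real.rpow_mul (by linarith)]
        congr 1; norm_num
      have hB := rpow_one_add_le_one_add_mul_self ht'.1 (by linarith : 0 ≤ r / 2) (by linarith)
      have hsq := pow_le_pow_left₀ (Real.rpow_nonneg (by linarith : 0 ≤ 1 + t) (r / 2)) hB 2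
      have hlast : t ^ 2 ≤ |t| ^ r := by
        rw [← sq_abs, ← Real.rpow_natCast]
        rcases (abs_nonneg t).eq_or_lt with h0 | h0
        · rw [← h0, Real.zero_rpow (by linarith : r ≠ 0)]; simp
        · exact Real.rpow_le_rpow_of_exponent_ge h0 ht (by norm_num; linarith)
      rw [e]
      nlinarith [mul_nonneg (sq_nonneg t) (by nlinarith : (0:ℝ) ≤ 4 - r ^ 2)]
    have := mul_le_mul_of_nonneg_left h hA
    rw [h1, h2]
    nlinarith
  · have h1 : |a + b| ^ r ≤ 4 * |b| ^ r := by
      calc |a + b| ^ r ≤ (2 * |b|) ^ r :=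
            Real.rpow_le_rpow (abs_nonneg _) (by linarith [abs_add_le a b]) (by linarith)
        _ = 2 ^ r * |b| ^ r := Real.mul_rpow (by norm_num) (abs_nonneg _)
        _ ≤ 4 * |b| ^ r := by
            refine mul_le_mul_of_nonneg_right ?_ hB
            calc (2:ℝ) ^ r ≤ 2 ^ (2:ℝ) := Real.rpow_le_rpow_of_exponent_le (by norm_num) hr2.le
              _ = 4 := by norm_num
    have h2 : |r * (a * |a| ^ (r - 2)) * b| ≤ 2 * |b| ^ r := by
      rw [abs_mul, abs_mul, abs_mul_abs_rpow_sub_two hr, abs_of_pos (by linarith : 0 < r)]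
      have : |a| ^ (r - 1) * |b| ≤ |b| ^ r := by
        calc |a| ^ (r - 1) * |b| ≤ |b| ^ (r - 1) * |b| :=
              mul_le_mul_of_nonneg_right
                (Real.rpow_le_rpow hpos.le hab (by linarith)) (abs_nonneg b)
          _ = |b| ^ r := by
              nth_rewrite 2 [← Real.rpow_one |b|]
              rw [← Real.rpow_add' (abs_nonneg b) (by linarith)]
              congr 1; ring
      nlinarith [mul_nonneg (Real.rpow_nonneg hpos.le (r - 1)) (abs_nonneg b)]
    have := (abs_le.1 h2).1
    linarith

/-! ### Power sums -/

lemma sum_Icc_rpow_sub_one_le {s : ℝ} (hs : 0 < s) (N : ℕ) :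
    ∑ n ∈ Finset.Icc 1 N, (n : ℝ) ^ (s - 1) ≤ (1 + 1 / s) * (N : ℝ) ^ s := by
  have hN : (0:ℝ) ≤ (N:ℝ) ^ s := by positivity
  rcases le_total 1 s with h1 | h1
  · have : ∑ n ∈ Finset.Icc 1 N, (n : ℝ) ^ (s - 1) ≤ (N:ℝ) ^ s := by
      calc ∑ n ∈ Finset.Icc 1 N, (n : ℝ) ^ (s - 1)
          ≤ ∑ n ∈ Finset.Icc 1 N, (N : ℝ) ^ (s - 1) := by
            refine Finset.sum_le_sum fun n hn => Real.rpow_le_rpow (by positivity) ?_ (by linarith)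
            exact_mod_cast (Finset.mem_Icc.1 hn).2
        _ = (N:ℝ) ^ s := by
            rw [Finset.sum_const, Nat.card_Icc, nsmul_eq_mul, Nat.add_sub_cancel]
            nth_rewrite 1 [← Real.rpow_one (N:ℝ)]
            rw [← Real.rpow_add' (by positivity) (by linarith)]
            congr 1; ring
    have h2 : 0 ≤ 1 / s * (N:ℝ) ^ s := by positivity
    linarith
  · have : ∑ n ∈ Finset.Icc 1 N, (n : ℝ) ^ (s - 1) ≤ 1 / s * (N:ℝ) ^ s := by
      clear hN
      induction N with
      | zero => simp [Real.zero_rpow hs.ne']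
      | succ N ih =>
        rw [Finset.sum_Icc_succ_top (by omega)]
        have hpos : (0:ℝ) < ((N + 1 : ℕ) : ℝ) := by positivity
        have hge : (1:ℝ) ≤ ((N + 1 : ℕ) : ℝ) := by exact_mod_cast Nat.succ_pos N
        have hN : (N : ℝ) = ((N + 1 : ℕ) : ℝ) * (1 + -(1 / ((N + 1 : ℕ) : ℝ))) := by
          field_simp; push_cast; ring
        -- Bernoulli's inequality gives `N ^ s ≤ (N + 1) ^ s - s * (N + 1) ^ (s - 1)`
        have hb := rpow_one_add_le_one_add_mul_self
          (s := -(1 / ((N + 1 : ℕ) : ℝ)))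
          (by rw [neg_le_neg_iff]; exact (div_le_one hpos).2 hge) hs.le h1
        have h0 : 0 ≤ 1 + -(1 / ((N + 1 : ℕ) : ℝ)) := by
          have := (div_le_one hpos).2 hge; linarith
        have hst : (N : ℝ) ^ s ≤ ((N + 1 : ℕ) : ℝ) ^ s - s * ((N + 1 : ℕ) : ℝ) ^ (s - 1) := by
          rw [hN, Real.mul_rpow hpos.le h0]
          have := mul_le_mul_of_nonneg_left hb (Real.rpow_nonneg hpos.le s)
          refine this.trans (le_of_eq ?_)
          rw [Real.rpow_sub_one hpos.ne']
          field_simp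
          ring
        have := mul_le_mul_of_nonneg_left hst (by positivity : 0 ≤ 1 / s)
        have e : 1 / s * (((N + 1 : ℕ) : ℝ) ^ s - s * ((N + 1 : ℕ) : ℝ) ^ (s - 1)) =
          1 / s * ((N + 1 : ℕ) : ℝ) ^ s - ((N + 1 : ℕ) : ℝ) ^ (s - 1) := by
          field_simp
        linarith
    linarith

lemma tsum_rpow_le_of_threshold {s β c : ℝ} (hs : 0 < s) (hβ : 0 < β) (hc : 0 < c) {y : ℝ}
    (hy : 0 ≤ y) :
    ∑' n : ℕ+, (if c * (n : ℝ) ^ β ≤ y then ENNReal.ofReal ((n : ℝ) ^ (s - 1)) else 0) ≤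
      ENNReal.ofReal ((1 + 1 / s) * (y / c) ^ (s / β)) := by
  set N := ⌊(y / c) ^ (1 / β)⌋₊ with hN
  have hyc : 0 ≤ y / c := by positivity
  have key : ∀ n : ℕ+, (if c * (n : ℝ) ^ β ≤ y then ENNReal.ofReal ((n : ℝ) ^ (s - 1)) else 0) ≤
      (fun n : ℕ => if n ∈ Finset.Icc 1 N then ENNReal.ofReal ((n : ℝ) ^ (s - 1)) else 0) n := by
    intro n
    dsimp only
    split_ifs with h1 h2
    · exact le_rfl
    · refine absurd (Finset.mem_Icc.2 ⟨n.pos, Nat.le_floor ?_⟩) h2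
      have : (n : ℝ) ^ β ≤ y / c := by rw [le_div_iff₀ hc]; linarith
      calc (n : ℝ) = ((n : ℝ) ^ β) ^ (1 / β) := by
            rw [← Real.rpow_mul (by positivity), mul_one_div_cancel hβ.ne', Real.rpow_one]
        _ ≤ _ := Real.rpow_le_rpow (by positivity) this (by positivity)
    · exact zero_le
    · exact le_rfl
  calc _ ≤ ∑' n : ℕ+, (fun n : ℕ => if n ∈ Finset.Icc 1 N then
          ENNReal.ofReal ((n : ℝ) ^ (s - 1)) else 0) n := ENNReal.tsum_le_tsum key
    _ ≤ ∑' n : ℕ, (if n ∈ Finset.Icc 1 N then ENNReal.ofReal ((n : ℝ) ^ (s - 1)) else 0) :=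
        ENNReal.tsum_comp_le_tsum_of_injective PNat.coe_injective _
    _ = ∑ n ∈ Finset.Icc 1 N, ENNReal.ofReal ((n : ℝ) ^ (s - 1)) := by
        rw [tsum_eq_sum (s := Finset.Icc 1 N) (fun n hn => if_neg hn)]
        exact Finset.sum_congr rfl fun n hn => if_pos hn
    _ = ENNReal.ofReal (∑ n ∈ Finset.Icc 1 N, (n : ℝ) ^ (s - 1)) :=
        (ENNReal.ofReal_sum_of_nonneg fun n _ => by positivity).symm
    _ ≤ _ := by
        refine ENNReal.ofReal_le_ofReal ((sum_Icc_rpow_sub_one_le hs N).trans ?_)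
        refine mul_le_mul_of_nonneg_left ?_ (by positivity)
        calc (N : ℝ) ^ s ≤ ((y / c) ^ (1 / β)) ^ s :=
              Real.rpow_le_rpow (by positivity) (Nat.floor_le (by positivity)) hs.le
          _ = _ := by
              rw [← Real.rpow_mul hyc]; congr 1; ring

/-! ### A maximal inequality for martingales in `𝕃^r`, `1 < r < 2` -/

lemma MeasureTheory.MemLp.integrable_abs_rpow {Ω : Type*} {mΩ : MeasurableSpace Ω} {μ : Measure Ω}
    {r : ℝ} (hr : 1 < r) {X : Ω → ℝ} (hX : MemLp X (ENNReal.ofReal r) μ) :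
    Integrable (fun ω => |X ω| ^ r) μ := by
  have := hX.integrable_norm_rpow (by simp; linarith) ENNReal.ofReal_ne_top
  rwa [ENNReal.toReal_ofReal (by linarith)] at this

lemma measurable_mul_abs_rpow (r : ℝ) : Measurable fun x : ℝ => x * |x| ^ r :=
  measurable_id.mul ((measurable_id.abs).pow_const r)

lemma measurable_abs_rpow (r : ℝ) : Measurable fun x : ℝ => |x| ^ r :=
  measurable_id.abs.pow_const r

lemma integrable_mul_abs_rpow_mul {Ω : Type*} {mΩ : MeasurableSpace Ω} {μ : Measure Ω}
    {r : ℝ} (hr : 1 < r) {X Y : Ω → ℝ} (hX : MemLp X (ENNReal.ofReal r) μ)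
    (hY : MemLp Y (ENNReal.ofReal r) μ) :
    Integrable (fun ω => (X ω * |X ω| ^ (r - 2)) * Y ω) μ := by
  refine ((hX.integrable_abs_rpow hr).add (hY.integrable_abs_rpow hr)).mono'
    (((measurable_mul_abs_rpow _).comp_aemeasurable hX.1.aemeasurable).mul
      hY.1.aemeasurable).aestronglyMeasurable (ae_of_all _ fun ω => ?_)
  rw [Real.norm_eq_abs, abs_mul, abs_mul_abs_rpow_sub_two hr]
  exact abs_rpow_mul_abs_le hr _ _

/-- A function whose integrals over the sets of `m` vanish is orthogonal to every `m`-measurable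
function. -/
lemma setIntegral_mul_eq_zero {Ω : Type*} {mΩ : MeasurableSpace Ω} {μ : Measure Ω}
    [IsProbabilityMeasure μ] {m : MeasurableSpace Ω} (hm : m ≤ mΩ) {X Y : Ω → ℝ}
    (hX : StronglyMeasurable[m] X) (hY : Integrable Y μ) (hXY : Integrable (X * Y) μ)
    (h0 : ∀ A, MeasurableSet[m] A → ∫ ω in A, Y ω ∂μ = 0) {A : Set Ω} (hA : MeasurableSet[m] A) :
    ∫ ω in A, (X * Y) ω ∂μ = 0 := by
  have hc : (0 : Ω → ℝ) =ᵐ[μ] μ[Y | m] :=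
    ae_eq_condExp_of_forall_setIntegral_eq hm hY (fun _ _ _ => (integrable_zero _ _ _).integrableOn)
      (fun s hs _ => by simp [h0 s hs]) aestronglyMeasurable_zero
  rw [← setIntegral_condExp hm hXY hA]
  have h1 : μ[X * Y | m] =ᵐ[μ] 0 := by
    filter_upwards [condExp_mul_of_stronglyMeasurable_left hX hXY hY, hc] with ω h2 h3
    rw [h2, Pi.mul_apply, ← h3]; simp
  rw [setIntegral_congr_ae (g := fun _ => 0) (hm _ hA) (h1.mono fun ω h _ => h)]
  simp

section Martingale

variable {Ω : Type*} {mΩ : MeasurableSpace Ω} {μ : Measure Ω} [IsProbabilityMeasure μ]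
  {ℱ : Filtration ℕ mΩ} {r : ℝ} {X : ℕ → Ω → ℝ}

lemma stronglyMeasurable_sum_range (hXm : ∀ k, StronglyMeasurable[ℱ (k + 1)] (X k)) (n : ℕ) :
    StronglyMeasurable[ℱ n] (∑ k ∈ Finset.range n, X k) :=
  Finset.stronglyMeasurable_sum _ fun k hk =>
    (hXm k).mono (ℱ.mono (Nat.succ_le_of_lt (Finset.mem_range.1 hk)))

lemma setIntegral_cross_term_eq_zero (hr : 1 < r)
    (hXm : ∀ k, StronglyMeasurable[ℱ (k + 1)] (X k))
    (hX : ∀ k, MemLp (X k) (ENNReal.ofReal r) μ)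
    (h0 : ∀ k A, MeasurableSet[ℱ k] A → ∫ ω in A, X k ω ∂μ = 0) (n : ℕ) {A : Set Ω}
    (hA : MeasurableSet[ℱ n] A) :
    ∫ ω in A, ((∑ k ∈ Finset.range n, X k) ω * |(∑ k ∈ Finset.range n, X k) ω| ^ (r - 2)) * X n ω ∂μ
      = 0 :=
  setIntegral_mul_eq_zero (ℱ.le n)
    (X := fun ω => (∑ k ∈ Finset.range n, X k) ω * |(∑ k ∈ Finset.range n, X k) ω| ^ (r - 2))
    ((measurable_mul_abs_rpow _).comp
      (stronglyMeasurable_sum_range hXm n).measurable).stronglyMeasurable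
    ((hX n).integrable (by simpa using hr.le))
    (integrable_mul_abs_rpow_mul hr (memLp_finsetSum' _ fun k _ => hX k) (hX n)) (h0 n) hA

lemma submartingale_abs_sum_rpow (hr : 1 < r)
    (hXm : ∀ k, StronglyMeasurable[ℱ (k + 1)] (X k))
    (hX : ∀ k, MemLp (X k) (ENNReal.ofReal r) μ)
    (h0 : ∀ k A, MeasurableSet[ℱ k] A → ∫ ω in A, X k ω ∂μ = 0) :
    Submartingale (fun n ω => |(∑ k ∈ Finset.range n, X k) ω| ^ r) ℱ μ := by
  have hS : ∀ n, MemLp (∑ k ∈ Finset.range n, X k) (ENNReal.ofReal r) μ :=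
    fun n => memLp_finsetSum' _ fun k _ => hX k
  refine submartingale_of_setIntegral_le_succ (fun n => ?_)
    (fun n => (hS n).integrable_abs_rpow hr) fun n A hA => ?_
  · exact ((measurable_abs_rpow r).comp
      (stronglyMeasurable_sum_range hXm n).measurable).stronglyMeasurable
  · have hi := (hS n).integrable_abs_rpow hr
    have hc := (integrable_mul_abs_rpow_mul hr (hS n) (hX n)).const_mul r
    have : ∫ ω in A, |(∑ k ∈ Finset.range n, X k) ω| ^ r ∂μ =
        ∫ ω in A, (|(∑ k ∈ Finset.range n, X k) ω| ^ r + r * (((∑ k ∈ Finset.range n, X k) ω *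
          |(∑ k ∈ Finset.range n, X k) ω| ^ (r - 2)) * X n ω)) ∂μ := by
      rw [integral_add hi.integrableOn hc.integrableOn, integral_const_mul,
        setIntegral_cross_term_eq_zero hr hXm hX h0 n hA]
      simp
    rw [this]
    refine setIntegral_mono (hi.add hc).integrableOn
      ((hS (n + 1)).integrable_abs_rpow hr).integrableOn fun ω => ?_
    dsimp only
    rw [Finset.sum_range_succ, Pi.add_apply, ← mul_assoc]
    exact abs_rpow_add_ge hr _ _

/-- The von Bahr–Esseen inequality. -/
lemma integral_abs_sum_rpow_le (hr : 1 < r) (hr2 : r < 2)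
    (hXm : ∀ k, StronglyMeasurable[ℱ (k + 1)] (X k))
    (hX : ∀ k, MemLp (X k) (ENNReal.ofReal r) μ)
    (h0 : ∀ k A, MeasurableSet[ℱ k] A → ∫ ω in A, X k ω ∂μ = 0) (n : ℕ) :
    ∫ ω, |(∑ k ∈ Finset.range n, X k) ω| ^ r ∂μ ≤
      6 * ∑ k ∈ Finset.range n, ∫ ω, |X k ω| ^ r ∂μ := by
  have hS : ∀ n, MemLp (∑ k ∈ Finset.range n, X k) (ENNReal.ofReal r) μ :=
    fun n => memLp_finsetSum' _ fun k _ => hX k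
  induction n with
  | zero => simp [Real.zero_rpow (by linarith : r ≠ 0)]
  | succ n ih =>
    have hi := (hS n).integrable_abs_rpow hr
    have hc := (integrable_mul_abs_rpow_mul hr (hS n) (hX n)).const_mul r
    have hd := ((hX n).integrable_abs_rpow hr).const_mul 6
    have hic : Integrable (fun ω => |(∑ k ∈ Finset.range n, X k) ω| ^ r +
        r * (((∑ k ∈ Finset.range n, X k) ω *
          |(∑ k ∈ Finset.range n, X k) ω| ^ (r - 2)) * X n ω)) μ := hi.add hc
    have hz := setIntegral_cross_term_eq_zero hr hXm hX h0 n MeasurableSet.univ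
    rw [setIntegral_univ] at hz
    calc ∫ ω, |(∑ k ∈ Finset.range (n + 1), X k) ω| ^ r ∂μ
        ≤ ∫ ω, (|(∑ k ∈ Finset.range n, X k) ω| ^ r + r * (((∑ k ∈ Finset.range n, X k) ω *
          |(∑ k ∈ Finset.range n, X k) ω| ^ (r - 2)) * X n ω) + 6 * |X n ω| ^ r) ∂μ := by
          refine integral_mono ((hS (n + 1)).integrable_abs_rpow hr) ((hi.add hc).add hd)
            fun ω => ?_
          dsimp only
          rw [Finset.sum_range_succ, Pi.add_apply, ← mul_assoc]
          exact abs_rpow_add_le hr hr2 _ _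
      _ = ∫ ω, |(∑ k ∈ Finset.range n, X k) ω| ^ r ∂μ + 6 * ∫ ω, |X n ω| ^ r ∂μ := by
          rw [integral_add hic hd, integral_add hi hc, integral_const_mul,
            integral_const_mul, hz]
          simp
      _ ≤ _ := by rw [Finset.sum_range_succ]; linarith

/-- Doob's maximal inequality for `|S_n| ^ r` combined with the von Bahr–Esseen inequality. -/
lemma measure_exists_abs_sum_ge_le (hr : 1 < r) (hr2 : r < 2)
    (hXm : ∀ k, StronglyMeasurable[ℱ (k + 1)] (X k))
    (hX : ∀ k, MemLp (X k) (ENNReal.ofReal r) μ)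
    (h0 : ∀ k A, MeasurableSet[ℱ k] A → ∫ ω in A, X k ω ∂μ = 0) (n : ℕ) {x : ℝ} (hx : 0 < x) :
    μ {ω | ∃ k ≤ n, x ≤ |(∑ j ∈ Finset.range k, X j) ω|} ≤
      ENNReal.ofReal (6 * (∑ k ∈ Finset.range n, ∫ ω, |X k ω| ^ r ∂μ) / x ^ r) := by
  have hxr : 0 < x ^ r := Real.rpow_pos_of_pos hx r
  have hmax := maximal_ineq (submartingale_abs_sum_rpow hr hXm hX h0)
    (fun n ω => Real.rpow_nonneg (abs_nonneg _) r) (ε := (x ^ r).toNNReal) n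
  rw [Real.coe_toNNReal _ hxr.le] at hmax
  have hsub : {ω | ∃ k ≤ n, x ≤ |(∑ j ∈ Finset.range k, X j) ω|} ⊆
      {ω | x ^ r ≤ (Finset.range (n + 1)).sup' Finset.nonempty_range_add_one
        fun k => |(∑ j ∈ Finset.range k, X j) ω| ^ r} := by
    rintro ω ⟨k, hk, h⟩
    have hr0 : 0 ≤ r := by linarith
    exact (Real.rpow_le_rpow hx.le h hr0).trans
      (Finset.le_sup' (fun k => |(∑ j ∈ Finset.range k, X j) ω| ^ r)
        (Finset.mem_range.2 (Nat.lt_succ_of_le hk)))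
  have hle : ∀ s : Set Ω, ∫ ω in s, |(∑ k ∈ Finset.range n, X k) ω| ^ r ∂μ ≤
      6 * ∑ k ∈ Finset.range n, ∫ ω, |X k ω| ^ r ∂μ := fun s =>
    (setIntegral_le_integral ((memLp_finsetSum' _ fun k _ => hX k).integrable_abs_rpow hr)
      (ae_of_all _ fun ω => Real.rpow_nonneg (abs_nonneg _) r)).trans
      (integral_abs_sum_rpow_le hr hr2 hXm hX h0 n)
  rw [ENNReal.ofReal_div_of_pos hxr, ENNReal.le_div_iff_mul_le (Or.inl (by simpa using hxr))
    (Or.inl ENNReal.ofReal_ne_top), mul_comm]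
  exact (mul_le_mul_right (measure_mono hsub) _).trans
    (hmax.trans (ENNReal.ofReal_le_ofReal (hle _)))

end Martingale

/-! ### The maximal function of a coboundary's transfer function -/

section Coboundary

variable {Ω : Type*} {mΩ : MeasurableSpace Ω} {μ : Measure Ω} {T : Ω → Ω}

/-- The orbit segment `0, …, n` is covered by `n / b + 1` segments of length `b`. -/
lemma measure_exists_le_orbit_le (hT : MeasurePreserving T μ μ) {A : Set Ω} (hA : MeasurableSet A)
    {b : ℕ} (hb : 0 < b) (n : ℕ) :
    μ {ω | ∃ k ≤ n, T^[k] ω ∈ A} ≤ (n / b + 1 : ℕ) * μ {ω | ∃ k < b, T^[k] ω ∈ A} := by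
  have hB : MeasurableSet {ω | ∃ k < b, T^[k] ω ∈ A} := by
    have : {ω | ∃ k < b, T^[k] ω ∈ A} = ⋃ k ∈ Finset.range b, T^[k] ⁻¹' A := by ext; simp
    rw [this]
    exact Finset.measurableSet_biUnion _ fun k _ => (hT.measurable.iterate k) hA
  have hsub : {ω | ∃ k ≤ n, T^[k] ω ∈ A} ⊆
      ⋃ i ∈ Finset.range (n / b + 1), T^[b * i] ⁻¹' {ω | ∃ k < b, T^[k] ω ∈ A} := by
    rintro ω ⟨k, hk, h⟩
    simp only [Set.mem_iUnion]
    refine ⟨k / b, Finset.mem_range.2 (Nat.lt_succ_of_le (Nat.div_le_div_right hk)), k % b,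
      Nat.mod_lt _ hb, ?_⟩
    rwa [← Function.iterate_add_apply, Nat.mod_add_div]
  refine (measure_mono hsub).trans ((measure_biUnion_finset_le _ _).trans (le_of_eq ?_))
  rw [Finset.sum_congr rfl fun i _ => (hT.iterate (b * i)).measure_preimage hB.nullMeasurableSet]
  simp

/-- Truncating `h` at the level `t` costs at most `b * t` in the sum, and Markov's inequality is
applied to the remaining part of `h`. -/
lemma measure_sum_orbit_ge_le (hT : MeasurePreserving T μ μ) {h : Ω → ℝ} (hh : Measurable h)
    {t : ℝ} (ht : 0 < t) {b : ℕ} (hb : 0 < b) :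
    μ {ω | 2 * b * t ≤ ∑ i ∈ Finset.range b, |h (T^[i] ω)|} ≤
      ENNReal.ofReal (1 / t) * ∫⁻ ω in {ω | t ≤ |h ω|}, ENNReal.ofReal |h ω| ∂μ := by
  have hset : MeasurableSet {ω | t ≤ |h ω|} := measurableSet_le measurable_const hh.abs
  set u : Ω → ℝ≥0∞ := {ω | t ≤ |h ω|}.indicator fun ω => ENNReal.ofReal |h ω| with hu
  have hum : Measurable u := hh.abs.ennreal_ofReal.indicator hset
  have hbt : 0 < (b : ℝ) * t := by positivity
  have hpt : ∀ ω, ENNReal.ofReal |h ω| ≤ u ω + ENNReal.ofReal t := fun ω => by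
    by_cases h1 : t ≤ |h ω|
    · rw [hu, Set.indicator_of_mem (by exact h1)]; exact le_self_add
    · exact (ENNReal.ofReal_le_ofReal (not_le.1 h1).le).trans le_add_self
  have hsub : {ω | 2 * b * t ≤ ∑ i ∈ Finset.range b, |h (T^[i] ω)|} ⊆
      {ω | ENNReal.ofReal (b * t) ≤ ∑ i ∈ Finset.range b, u (T^[i] ω)} := by
    intro ω hω
    have h1 : ENNReal.ofReal (b * t) + ENNReal.ofReal (b * t) ≤
        ∑ i ∈ Finset.range b, u (T^[i] ω) + ENNReal.ofReal (b * t) := by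
      calc _ = ENNReal.ofReal (2 * b * t) := by
            rw [← ENNReal.ofReal_add hbt.le hbt.le]; congr 1; ring
        _ ≤ ENNReal.ofReal (∑ i ∈ Finset.range b, |h (T^[i] ω)|) := ENNReal.ofReal_le_ofReal hω
        _ = ∑ i ∈ Finset.range b, ENNReal.ofReal |h (T^[i] ω)| :=
            ENNReal.ofReal_sum_of_nonneg fun _ _ => abs_nonneg _
        _ ≤ ∑ i ∈ Finset.range b, (u (T^[i] ω) + ENNReal.ofReal t) :=
            Finset.sum_le_sum fun i _ => hpt _
        _ = _ := by
            rw [Finset.sum_add_distrib, Finset.sum_const, Finset.card_range, nsmul_eq_mul,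
              ENNReal.ofReal_mul (by positivity), ENNReal.ofReal_natCast]
    exact (ENNReal.add_le_add_iff_right ENNReal.ofReal_ne_top).1 h1
  refine (measure_mono hsub).trans ?_
  refine (meas_ge_le_lintegral_div (Finset.measurable_fun_sum _ fun i _ =>
    hum.comp (hT.measurable.iterate i)).aemeasurable (by simpa using ⟨hb.ne', ht⟩)
    ENNReal.ofReal_ne_top).trans (le_of_eq ?_)
  rw [lintegral_finsetSum _ fun i _ => hum.comp (hT.measurable.iterate i),
    Finset.sum_congr rfl fun i _ => by exact (hT.iterate i).lintegral_comp hum, Finset.sum_const,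
    Finset.card_range, nsmul_eq_mul, hu, lintegral_indicator hset, one_div,
    ENNReal.ofReal_inv_of_pos ht, ENNReal.ofReal_mul (by positivity), ENNReal.ofReal_natCast,
    ENNReal.mul_div_mul_left _ _ (by simpa using hb.ne') (by simp), ENNReal.div_eq_inv_mul]

lemma abs_iterate_le_add_sum (g : Ω → ℝ) (ω : Ω) {k b : ℕ} (hk : k < b) :
    |g (T^[k] ω)| ≤ |g ω| + ∑ i ∈ Finset.range b, |g (T^[i] ω) - g (T (T^[i] ω))| := by
  have h1 : g ω - g (T^[k] ω) = ∑ i ∈ Finset.range k, (g (T^[i] ω) - g (T (T^[i] ω))) := by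
    have := Finset.sum_range_sub' (fun i => g (T^[i] ω)) k
    simpa only [Function.iterate_succ_apply', Function.iterate_zero, id] using this.symm
  have h2 : |g ω - g (T^[k] ω)| ≤ ∑ i ∈ Finset.range b, |g (T^[i] ω) - g (T (T^[i] ω))| := by
    rw [h1]
    exact (Finset.abs_sum_le_sum_abs _ _).trans (Finset.sum_le_sum_of_subset_of_nonneg
      (Finset.range_subset_range.2 hk.le) fun _ _ _ => abs_nonneg _)
  have h3 := abs_sub_abs_le_abs_sub (g (T^[k] ω)) (g ω)
  rw [abs_sub_comm] at h2
  linarith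

lemma measure_exists_orbit_ge_le (hT : MeasurePreserving T μ μ) {g : Ω → ℝ} (hg : Measurable g)
    {x t : ℝ} (ht : 0 < t) {b : ℕ} (hb : 0 < b) (hx : 4 * b * t ≤ x) (n : ℕ) :
    μ {ω | ∃ k ≤ n, x ≤ |g (T^[k] ω)|} ≤ (n / b + 1 : ℕ) * (μ {ω | x / 2 ≤ |g ω|} +
      ENNReal.ofReal (1 / t) *
        ∫⁻ ω in {ω | t ≤ |g ω - g (T ω)|}, ENNReal.ofReal |g ω - g (T ω)| ∂μ) := by
  have h1 := measure_exists_le_orbit_le hT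
    (measurableSet_le measurable_const hg.abs : MeasurableSet {ω | x ≤ |g ω|}) hb n
  refine h1.trans (mul_le_mul_right ?_ _)
  refine le_trans (measure_mono ?_) ((measure_union_le _ _).trans (add_le_add_right
    (measure_sum_orbit_ge_le hT (hg.sub (hg.comp hT.measurable)) ht hb) _))
  rintro ω ⟨k, hk, h⟩
  by_cases h2 : x / 2 ≤ |g ω|
  · exact Or.inl h2
  · refine Or.inr ?_
    have h3 := abs_iterate_le_add_sum (T := T) g ω hk
    simp only [Set.mem_ofPred_eq, Pi.sub_apply, Function.comp_apply] at h ⊢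
    linarith

/-- A series of tail probabilities, weighted by powers, is dominated by a moment. -/
lemma tsum_rpow_mul_setLIntegral_le {s β c : ℝ} (hs : 0 < s) (hβ : 0 < β) (hc : 0 < c)
    {y : Ω → ℝ} (hy : Measurable y) {w : Ω → ℝ≥0∞} (hw : Measurable w) :
    ∑' n : ℕ+, ENNReal.ofReal ((n : ℝ) ^ (s - 1)) *
        ∫⁻ ω in {ω | c * (n : ℝ) ^ β ≤ |y ω|}, w ω ∂μ ≤
      ∫⁻ ω, ENNReal.ofReal ((1 + 1 / s) * (|y ω| / c) ^ (s / β)) * w ω ∂μ := by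
  have hset : ∀ n : ℕ+, MeasurableSet {ω | c * (n : ℝ) ^ β ≤ |y ω|} := fun n =>
    measurableSet_le measurable_const hy.abs
  have h1 : ∀ n : ℕ+, ENNReal.ofReal ((n : ℝ) ^ (s - 1)) *
      ∫⁻ ω in {ω | c * (n : ℝ) ^ β ≤ |y ω|}, w ω ∂μ =
      ∫⁻ ω, {ω | c * (n : ℝ) ^ β ≤ |y ω|}.indicator
        (fun ω => ENNReal.ofReal ((n : ℝ) ^ (s - 1)) * w ω) ω ∂μ := fun n => by
    rw [lintegral_indicator (hset n), lintegral_const_mul _ hw]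
  simp_rw [h1]
  rw [← lintegral_tsum fun n => ((hw.const_mul _).indicator (hset n)).aemeasurable]
  refine lintegral_mono fun ω => ?_
  dsimp only
  calc _ = ∑' n : ℕ+, (if c * (n : ℝ) ^ β ≤ |y ω| then
        ENNReal.ofReal ((n : ℝ) ^ (s - 1)) else 0) * w ω := by
        refine tsum_congr fun n => ?_
        simp only [Set.indicator_apply, Set.mem_ofPred_eq, ite_mul, zero_mul]
    _ = (∑' n : ℕ+, (if c * (n : ℝ) ^ β ≤ |y ω| then
        ENNReal.ofReal ((n : ℝ) ^ (s - 1)) else 0)) * w ω := ENNReal.tsum_mul_right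
    _ ≤ _ := mul_le_mul_left (tsum_rpow_le_of_threshold hs hβ hc (abs_nonneg _)) _

/-- If `g - g ∘ T` is in `𝕃^r` and `|g|` has a moment of order `(p - 1) * r / (r - 1)`, which is
smaller than `p`, the maxima of `|g|` along orbits behave as if `g` were in `𝕃^p`. -/
lemma tsum_rpow_mul_measure_exists_orbit_ge_lt_top (hT : MeasurePreserving T μ μ) {p r : ℝ}
    (hp : 1 < p) (hpr : p < r) {g : Ω → ℝ} (hg : Measurable g)
    (hgq : Integrable (fun ω => |g ω| ^ ((p - 1) * r / (r - 1))) μ)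
    (hgr : Integrable (fun ω => |g ω - g (T ω)| ^ r) μ)
    {c : ℝ} (hc : 0 < c) {α : ℝ} (hα0 : 0 < α) (hα1 : α ≤ 1) :
    ∑' n : ℕ+, ENNReal.ofReal ((n : ℝ) ^ (α * p - 2)) *
      μ {ω | ∃ k ≤ (n : ℕ), c * (n : ℝ) ^ α ≤ |g (T^[k] ω)|} < ∞ := by
  set θ := (p - 1) / (r - 1) with hθ
  have hr1 : 0 < r - 1 := by linarith
  have hθ0 : 0 < θ := div_pos (by linarith) hr1
  have hθ1 : θ < 1 := (div_lt_one hr1).2 (by linarith)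
  have hh : Measurable fun ω => g ω - g (T ω) := hg.sub (hg.comp hT.measurable)
  have hs1 : 0 < α * (p - 1 + θ) := mul_pos hα0 (by linarith)
  have hs2 : 0 < α * (p - 1) := mul_pos hα0 (by linarith)
  have hterm : ∀ n : ℕ+, ENNReal.ofReal ((n : ℝ) ^ (α * p - 2)) *
      μ {ω | ∃ k ≤ (n : ℕ), c * (n : ℝ) ^ α ≤ |g (T^[k] ω)|} ≤
      2 * (ENNReal.ofReal ((n : ℝ) ^ (α * (p - 1 + θ) - 1)) *
        ∫⁻ ω in {ω | c / 2 * (n : ℝ) ^ α ≤ |g ω|}, 1 ∂μ) +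
      ENNReal.ofReal (16 / c) * (ENNReal.ofReal ((n : ℝ) ^ (α * (p - 1) - 1)) *
        ∫⁻ ω in {ω | c / 8 * (n : ℝ) ^ (α * θ) ≤ |g ω - g (T ω)|},
          ENNReal.ofReal |g ω - g (T ω)| ∂μ) := by
    intro n
    have hn1 : (1 : ℝ) ≤ n := by exact_mod_cast n.pos
    have hn : (0 : ℝ) < n := by linarith
    -- the block length balances the two terms of `measure_exists_orbit_ge_le`
    set L : ℝ := (n : ℝ) ^ (α * (1 - θ)) with hL
    have hL1 : 1 ≤ L := Real.one_le_rpow hn1 (by nlinarith)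
    have hLn : L ≤ n := by
      calc L ≤ (n : ℝ) ^ (1 : ℝ) := Real.rpow_le_rpow_of_exponent_le hn1 (by nlinarith)
        _ = n := Real.rpow_one _
    set b := ⌈L⌉₊ with hb
    have hLb : L ≤ b := Nat.le_ceil L
    have hb2 : (b : ℝ) ≤ 2 * L := by linarith [Nat.ceil_lt_add_one (by linarith : 0 ≤ L)]
    have hbn : b ≤ n := Nat.ceil_le.2 hLn
    have hb0 : 0 < b := Nat.ceil_pos.2 (by linarith)
    have ht : 0 < c / 8 * (n : ℝ) ^ (α * θ) := by positivity
    have hx : 4 * b * (c / 8 * (n : ℝ) ^ (α * θ)) ≤ c * (n : ℝ) ^ α := by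
      have e : L * (n : ℝ) ^ (α * θ) = (n : ℝ) ^ α := by
        rw [hL, ← Real.rpow_add hn]; congr 1; ring
      calc 4 * b * (c / 8 * (n : ℝ) ^ (α * θ))
          ≤ 4 * (2 * L) * (c / 8 * (n : ℝ) ^ (α * θ)) := by gcongr
        _ = c * (L * (n : ℝ) ^ (α * θ)) := by ring
        _ = _ := by rw [e]
    have hcount : ((n / b + 1 : ℕ) : ℝ≥0∞) ≤ ENNReal.ofReal (2 * (n / L)) := by
      rw [← ENNReal.ofReal_natCast]
      refine ENNReal.ofReal_le_ofReal ?_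
      have h1 : (((n : ℕ) / b : ℕ) : ℝ) ≤ n / b := Nat.cast_div_le
      have h2 : (n : ℝ) / b ≤ n / L := by gcongr
      have h3 : 1 ≤ (n : ℝ) / L := (one_le_div (by linarith)).2 hLn
      push_cast at h1 ⊢
      linarith
    have hm := measure_exists_orbit_ge_le hT hg ht hb0 hx n
    have e1 : (n : ℝ) ^ (α * p - 2) * (2 * (n / L)) = 2 * (n : ℝ) ^ (α * (p - 1 + θ) - 1) := by
      have : (n : ℝ) / L = (n : ℝ) ^ (1 - α * (1 - θ)) := by
        rw [hL, Real.rpow_sub hn, Real.rpow_one]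
      rw [this, mul_left_comm, ← Real.rpow_add hn]
      congr 2; ring
    have e2 : (n : ℝ) ^ (α * p - 2) * (2 * (n / L)) * (1 / (c / 8 * (n : ℝ) ^ (α * θ))) =
        16 / c * (n : ℝ) ^ (α * (p - 1) - 1) := by
      have : (n : ℝ) ^ (α * (p - 1 + θ) - 1) = (n : ℝ) ^ (α * (p - 1) - 1) * (n : ℝ) ^ (α * θ) := by
        rw [← Real.rpow_add hn]; congr 1; ring
      rw [e1, this]
      have : (n : ℝ) ^ (α * θ) ≠ 0 := by positivity
      field_simp
      norm_num
    have hpn : 0 ≤ (n : ℝ) ^ (α * p - 2) := by positivity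
    have hset : {ω | c * (n : ℝ) ^ α / 2 ≤ |g ω|} = {ω | c / 2 * (n : ℝ) ^ α ≤ |g ω|} := by
      ext ω; rw [Set.mem_ofPred_eq, Set.mem_ofPred_eq, div_mul_eq_mul_div]
    have E1 : ENNReal.ofReal ((n : ℝ) ^ (α * p - 2)) * ENNReal.ofReal (2 * (n / L)) =
        2 * ENNReal.ofReal ((n : ℝ) ^ (α * (p - 1 + θ) - 1)) := by
      rw [← ENNReal.ofReal_mul hpn, e1, ENNReal.ofReal_mul (by norm_num), ENNReal.ofReal_ofNat]
    have E2 : ENNReal.ofReal ((n : ℝ) ^ (α * p - 2)) * ENNReal.ofReal (2 * (n / L)) *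
        ENNReal.ofReal (1 / (c / 8 * (n : ℝ) ^ (α * θ))) =
        ENNReal.ofReal (16 / c) * ENNReal.ofReal ((n : ℝ) ^ (α * (p - 1) - 1)) := by
      rw [← ENNReal.ofReal_mul hpn, ← ENNReal.ofReal_mul (by positivity), e2,
        ENNReal.ofReal_mul (by positivity)]
    rw [setLIntegral_one, ← hset, ← mul_assoc 2, ← mul_assoc (ENNReal.ofReal (16 / c)), ← E1, ← E2]
    refine (mul_le_mul_right (hm.trans (mul_le_mul_left hcount _)) _).trans (le_of_eq ?_)
    ring
  have hexp1 : α * (p - 1 + θ) / α = (p - 1) * r / (r - 1) := by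
    rw [hθ]; field_simp; ring
  have hexp2 : α * (p - 1) / (α * θ) = r - 1 := by
    have : p - 1 ≠ 0 := by linarith
    rw [hθ]; field_simp
  refine (ENNReal.tsum_le_tsum hterm).trans_lt ?_
  rw [ENNReal.tsum_add, ENNReal.tsum_mul_left, ENNReal.tsum_mul_left]
  refine ENNReal.add_lt_top.2 ⟨ENNReal.mul_lt_top (by simp) ((tsum_rpow_mul_setLIntegral_le hs1 hα0
    (by positivity) hg measurable_const).trans_lt ?_), ENNReal.mul_lt_top (by simp)
    ((tsum_rpow_mul_setLIntegral_le hs2 (mul_pos hα0 hθ0) (by positivity) hh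
      hh.abs.ennreal_ofReal).trans_lt ?_)⟩
  · rw [hexp1]
    simp only [mul_one]
    refine Integrable.lintegral_lt_top ?_
    simp_rw [Real.div_rpow (abs_nonneg _) (by positivity : 0 ≤ c / 2)]
    exact (hgq.div_const _).const_mul _
  · rw [hexp2]
    have : ∀ ω, ENNReal.ofReal ((1 + 1 / (α * (p - 1))) *
        (|g ω - g (T ω)| / (c / 8)) ^ (r - 1)) * ENNReal.ofReal |g ω - g (T ω)| =
        ENNReal.ofReal ((1 + 1 / (α * (p - 1))) *
          (|g ω - g (T ω)| ^ r / (c / 8) ^ (r - 1))) := fun ω => by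
      rw [← ENNReal.ofReal_mul (by positivity), Real.div_rpow (abs_nonneg _) (by positivity)]
      congr 1
      have : |g ω - g (T ω)| ^ r = |g ω - g (T ω)| ^ (r - 1) * |g ω - g (T ω)| := by
        nth_rewrite 3 [← Real.rpow_one |g ω - g (T ω)|]
        rw [← Real.rpow_add' (abs_nonneg _) (by linarith)]
        congr 1; ring
      rw [this]; ring
    simp_rw [this]
    exact Integrable.lintegral_lt_top ((hgr.div_const _).const_mul _)

end Coboundary

/-! ### The martingale-coboundary decomposition -/

section Decomposition

-- `M` comes before `mΩ`, so that `mΩ` is the instance found by default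
variable {Ω : Type*} {M mΩ : MeasurableSpace Ω} {μ : Measure Ω}

lemma le_comap_of_image {T : Ω ≃ᵐ Ω}
    (hTM : ∀ A : Set Ω, MeasurableSet[M] A → MeasurableSet[M] (T '' A)) : M ≤ M.comap T :=
  fun A hA => ⟨T '' A, hTM A hA, Set.preimage_image_eq A T.injective⟩

/-- The filtration `k ↦ T⁻ᵏ M`, which is increasing when `M ⊆ T⁻¹ M`. -/
def comapFiltration {T : Ω → Ω} (hT : Measurable T) (hM : M ≤ mΩ)
    (hTM : M ≤ M.comap T) : Filtration ℕ mΩ where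
  seq k := M.comap T^[k]
  mono' := monotone_nat_of_le_succ fun k => by
    rw [Function.iterate_succ', ← MeasurableSpace.comap_comp]
    exact MeasurableSpace.comap_mono hTM
  le' k := (MeasurableSpace.comap_mono hM).trans (hT.iterate k).comap_le

lemma setIntegral_comp_measurePreserving {T : Ω → Ω} (hT : MeasurePreserving T μ μ) {F : Ω → ℝ}
    (hF : AEStronglyMeasurable F μ) {A : Set Ω} (hA : MeasurableSet A) :
    ∫ ω in T ⁻¹' A, F (T ω) ∂μ = ∫ ω in A, F ω ∂μ := by
  have h := setIntegral_map hA (hT.map_eq.symm ▸ hF : AEStronglyMeasurable F (μ.map T))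
    hT.measurable.aemeasurable
  rw [hT.map_eq] at h
  exact h.symm

lemma tsum_rpow_mul_measure_exists_birkhoffSum_ge_lt_top [IsProbabilityMeasure μ] {T : Ω → Ω}
    (hT : MeasurePreserving T μ μ) (hM : M ≤ mΩ) (hTM : M ≤ M.comap T)
    {p r : ℝ} (hr : 1 < r) (hpr : p < r) (hr2 : r < 2) {d : Ω → ℝ}
    (hdm : Measurable[M.comap T] d) (hd : MemLp d (ENNReal.ofReal r) μ)
    (hd0 : ∀ A, MeasurableSet[M] A → ∫ ω in A, d ω ∂μ = 0) {c : ℝ} (hc : 0 < c) {α : ℝ}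
    (hα : 0 < α) :
    ∑' n : ℕ+, ENNReal.ofReal ((n : ℝ) ^ (α * p - 2)) *
      μ {ω | ∃ k ≤ (n : ℕ), c * (n : ℝ) ^ α ≤ |birkhoffSum T d k ω|} < ∞ := by
  set X : ℕ → Ω → ℝ := fun k => d ∘ T^[k] with hX
  have hXm : ∀ k, StronglyMeasurable[comapFiltration hT.measurable hM hTM (k + 1)] (X k) :=
    fun k => by
      refine Measurable.stronglyMeasurable ?_
      change Measurable[M.comap T^[k + 1]] (d ∘ T^[k])
      rw [Function.iterate_succ', ← MeasurableSpace.comap_comp]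
      exact hdm.comp (comap_measurable _)
  have hXL : ∀ k, MemLp (X k) (ENNReal.ofReal r) μ :=
    fun k => hd.comp_measurePreserving (hT.iterate k)
  have hX0 : ∀ k A, MeasurableSet[comapFiltration hT.measurable hM hTM k] A →
      ∫ ω in A, X k ω ∂μ = 0 := by
    rintro k _ ⟨B, hB, rfl⟩
    exact (setIntegral_comp_measurePreserving (hT.iterate k) hd.1 (hM _ hB)).trans (hd0 B hB)
  have hXr : ∀ k, ∫ ω, |X k ω| ^ r ∂μ = ∫ ω, |d ω| ^ r ∂μ := fun k => by
    have := setIntegral_comp_measurePreserving (hT.iterate k) (hd.integrable_abs_rpow hr).1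
      MeasurableSet.univ
    rwa [Set.preimage_univ, setIntegral_univ, setIntegral_univ] at this
  set E := ∫ ω, |d ω| ^ r ∂μ with hE
  have hterm : ∀ n : ℕ+, ENNReal.ofReal ((n : ℝ) ^ (α * p - 2)) *
      μ {ω | ∃ k ≤ (n : ℕ), c * (n : ℝ) ^ α ≤ |birkhoffSum T d k ω|} ≤
      (fun n : ℕ => ENNReal.ofReal (6 * E / c ^ r * (n : ℝ) ^ (α * (p - r) - 1))) n := by
    intro n
    have hn : (0 : ℝ) < n := by exact_mod_cast n.pos
    have h := measure_exists_abs_sum_ge_le hr hr2 hXm hXL hX0 n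
      (by positivity : 0 < c * (n : ℝ) ^ α)
    simp only [hXr, Finset.sum_const, Finset.card_range, nsmul_eq_mul, Finset.sum_apply] at h
    refine (mul_le_mul_right h _).trans (le_of_eq ?_)
    rw [← ENNReal.ofReal_mul (by positivity), Real.mul_rpow hc.le (by positivity),
      ← Real.rpow_mul hn.le]
    have : (n : ℝ) ^ (α * (p - r) - 1) = (n : ℝ) ^ (α * p - 2) * n / (n : ℝ) ^ (α * r) := by
      nth_rewrite 3 [← Real.rpow_one (n : ℝ)]
      rw [← Real.rpow_add hn, ← Real.rpow_sub hn]
      congr 1; ring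
    dsimp only
    rw [this]
    congr 1
    field_simp
  refine (ENNReal.tsum_le_tsum hterm).trans_lt
    ((ENNReal.tsum_comp_le_tsum_of_injective PNat.coe_injective
      fun n : ℕ => ENNReal.ofReal (6 * E / c ^ r * (n : ℝ) ^ (α * (p - r) - 1))).trans_lt ?_)
  refine Summable.tsum_ofReal_lt_top ((Real.summable_nat_rpow.2 ?_).mul_left _)
  nlinarith

lemma ae_eq_of_tendsto_eLpNorm_one {u : ℕ → Ω → ℝ} {a b : Ω → ℝ}
    (hu : ∀ n, AEStronglyMeasurable (u n) μ) (ha : AEStronglyMeasurable a μ)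
    (hb : AEStronglyMeasurable b μ) (hua : Tendsto (fun n => eLpNorm (u n - a) 1 μ) atTop (𝓝 0))
    (hub : Tendsto (fun n => eLpNorm (u n - b) 1 μ) atTop (𝓝 0)) : a =ᵐ[μ] b :=
  tendstoInMeasure_ae_unique (tendstoInMeasure_of_tendsto_eLpNorm one_ne_zero hu ha hua)
    (tendstoInMeasure_of_tendsto_eLpNorm one_ne_zero hu hb hub)

lemma tendsto_eLpNorm_one [IsProbabilityMeasure μ] {u : ℕ → Ω → ℝ} {a : Ω → ℝ} {q : ℝ≥0∞}
    (hq : 1 ≤ q) (hu : ∀ n, AEStronglyMeasurable (u n) μ) (ha : AEStronglyMeasurable a μ)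
    (h : Tendsto (fun n => eLpNorm (u n - a) q μ) atTop (𝓝 0)) :
    Tendsto (fun n => eLpNorm (u n - a) 1 μ) atTop (𝓝 0) :=
  tendsto_of_tendsto_of_tendsto_of_le_of_le tendsto_const_nhds h (fun _ => zero_le)
    fun n => eLpNorm_le_eLpNorm_of_exponent_le hq ((hu n).sub ha)

/-- The transfer function is the limit of `E[S_n(f) | M]`. That `f - g + g ∘ T` integrates to zero
over `A ∈ M` comes from passing to the limit in
`∫_A E[S_n(f) | M] ∘ T = ∫_{T A} S_n(f) = ∫_A E[S_{n+1}(f) | M] - ∫_A f`, which uses `T A ∈ M`. -/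
lemma exists_transfer_function [IsProbabilityMeasure μ] {T : Ω ≃ᵐ Ω} (hT : MeasurePreserving T μ μ)
    (hM : M ≤ mΩ)
    (hTM : ∀ A : Set Ω, MeasurableSet[M] A → MeasurableSet[M] (T '' A))
    {f : Ω → ℝ} (hf : Integrable f μ) {q r : ℝ≥0∞} (hq : 1 ≤ q) (hr : 1 ≤ r)
    (h₁ : ConvergesInLp (fun n => μ[birkhoffSum T f n | M]) q μ)
    (h₂ : ConvergesInLp (fun n => μ[birkhoffSum T f n | M] - μ[birkhoffSum T f n | M] ∘ T) r μ) :
    ∃ g : Ω → ℝ, Measurable[M] g ∧ MemLp g q μ ∧ MemLp (g - g ∘ T) r μ ∧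
      ∀ A, MeasurableSet[M] A → ∫ ω in A, (f - (g - g ∘ T)) ω ∂μ = 0 := by
  obtain ⟨hu, g₀, hg₀, hlim₀⟩ := h₁
  obtain ⟨hv, H, hH, hlimH⟩ := h₂
  set u : ℕ → Ω → ℝ := fun n => μ[birkhoffSum T f n | M] with hu_def
  have hum : ∀ n, AEStronglyMeasurable (u n) μ := fun n => (hu n).1
  have hui : ∀ n, Integrable (u n) μ := fun n => integrable_condExp
  have hg₀i : Integrable g₀ μ := hg₀.integrable hq
  have hlim₀' := tendsto_eLpNorm_one hq hum hg₀.1 hlim₀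
  set g : Ω → ℝ := μ[g₀ | M] with hg_def
  have hgi : Integrable g μ := integrable_condExp
  have hg : Tendsto (fun n => eLpNorm (u n - g) 1 μ) atTop (𝓝 0) := by
    refine tendsto_of_tendsto_of_tendsto_of_le_of_le tendsto_const_nhds hlim₀'
      (fun _ => zero_le) fun n => ?_
    have : u n - g =ᵐ[μ] μ[u n - g₀ | M] := by
      refine EventuallyEq.trans ?_ (condExp_sub (hui n) hg₀i M).symm
      rw [condExp_of_stronglyMeasurable hM stronglyMeasurable_condExp (hui n)]
    dsimp only
    rw [eLpNorm_congr_ae this]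
    exact eLpNorm_condExp_le_eLpNorm _ le_rfl
  have hgg : g₀ =ᵐ[μ] g := ae_eq_of_tendsto_eLpNorm_one hum hg₀.1 hgi.1 hlim₀' hg
  have hgT : Tendsto (fun n => eLpNorm (u n ∘ T - g ∘ T) 1 μ) atTop (𝓝 0) := by
    refine hg.congr fun n => ?_
    exact (eLpNorm_comp_measurePreserving ((hum n).sub hgi.1) hT).symm
  have huT : ∀ n, Integrable (u n ∘ T) μ := fun n => hT.integrable_comp_of_integrable (hui n)
  have hgTi : Integrable (g ∘ T) μ := hT.integrable_comp_of_integrable hgi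
  have hHg : H =ᵐ[μ] g - g ∘ T := by
    refine ae_eq_of_tendsto_eLpNorm_one (fun n => (hv n).1) hH.1 (hgi.1.sub hgTi.1)
      (tendsto_eLpNorm_one hr (fun n => (hv n).1) hH.1 hlimH) ?_
    refine tendsto_of_tendsto_of_tendsto_of_le_of_le tendsto_const_nhds
      (by simpa using hg.add hgT) (fun _ => zero_le) fun n => ?_
    have : u n - u n ∘ T - (g - g ∘ T) = (u n - g) - (u n ∘ T - g ∘ T) := by abel
    dsimp only
    rw [this]
    exact eLpNorm_sub_le ((hum n).sub hgi.1) ((huT n).1.sub hgTi.1) le_rfl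
  refine ⟨g, stronglyMeasurable_condExp.measurable, hg₀.ae_eq hgg, hH.ae_eq hHg, fun A hA => ?_⟩
  have hA' := hM A hA
  have hS : ∀ n, Integrable (birkhoffSum T f n) μ := fun n =>
    integrable_finsetSum _ fun k _ => (hT.iterate k).integrable_comp_of_integrable hf
  have hstep : ∀ n, ∫ ω in A, (u n ∘ T) ω ∂μ = ∫ ω in A, u (n + 1) ω ∂μ - ∫ ω in A, f ω ∂μ := by
    intro n
    have hpre : T ⁻¹' (T '' A) = A := Set.preimage_image_eq A T.injective
    have hTA := hTM A hA
    have e1 := setIntegral_comp_measurePreserving hT (hum n) (hM _ hTA)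
    have e2 := setIntegral_comp_measurePreserving hT (hS n).1 (hM _ hTA)
    rw [hpre] at e1 e2
    have e3 : ∀ ω, birkhoffSum T f n (T ω) = birkhoffSum T f (n + 1) ω - f ω := fun ω => by
      rw [birkhoffSum_succ']; ring
    calc ∫ ω in A, (u n ∘ T) ω ∂μ = ∫ ω in A, birkhoffSum T f n (T ω) ∂μ := by
          rw [e2, ← setIntegral_condExp hM (hS n) hTA]; exact e1
      _ = ∫ ω in A, birkhoffSum T f (n + 1) ω ∂μ - ∫ ω in A, f ω ∂μ := by
          simp_rw [e3]
          exact integral_sub (hS (n + 1)).integrableOn hf.integrableOn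
      _ = _ := by rw [← setIntegral_condExp hM (hS (n + 1)) hA]
  have l1 : Tendsto (fun n => ∫ ω in A, (u n ∘ T) ω ∂μ) atTop (𝓝 (∫ ω in A, (g ∘ T) ω ∂μ)) :=
    tendsto_setIntegral_of_L1' _ hgTi.1 (Eventually.of_forall huT) hgT A
  have l2 : Tendsto (fun n => ∫ ω in A, u n ω ∂μ) atTop (𝓝 (∫ ω in A, g ω ∂μ)) :=
    tendsto_setIntegral_of_L1' _ hgi.1 (Eventually.of_forall hui) hg A
  have l3 := tendsto_nhds_unique l1
    ((((tendsto_add_atTop_iff_nat 1).2 l2).sub_const _).congr fun n => (hstep n).symm)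
  have e4 : ∫ ω in A, (f - (g - g ∘ T)) ω ∂μ =
      ∫ ω in A, f ω ∂μ - (∫ ω in A, g ω ∂μ - ∫ ω in A, (g ∘ T) ω ∂μ) := by
    rw [← integral_sub hgi.integrableOn hgTi.integrableOn]
    exact integral_sub hf.integrableOn (hgi.sub hgTi).integrableOn
  rw [e4, l3]; ring

lemma birkhoffSum_eq_add_coboundary (T : Ω → Ω) (f g : Ω → ℝ) (n : ℕ) (ω : Ω) :
    birkhoffSum T f n ω = birkhoffSum T (f - (g - g ∘ T)) n ω + (g ω - g (T^[n] ω)) := by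
  have h1 : g ω - g (T^[n] ω) = birkhoffSum T (g - g ∘ T) n ω := by
    have := Finset.sum_range_sub' (fun i => g (T^[i] ω)) n
    simpa only [birkhoffSum, Pi.sub_apply, Function.comp_apply, Function.iterate_succ_apply',
      Function.iterate_zero, id] using this.symm
  rw [h1, birkhoffSum_sub]
  ring

end Decomposition

theorem corollary2p8 {Ω : Type*} {mΩ : MeasurableSpace Ω} (μ : Measure Ω) [IsProbabilityMeasure μ]
    (T : Ω ≃ᵐ Ω) (hT : MeasurePreserving T μ μ)
    (M : MeasurableSpace Ω) (hM : M ≤ mΩ)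
    (hTM : ∀ A : Set Ω, MeasurableSet[M] A → MeasurableSet[M] (T '' A))
    (p r : ℝ) (hp : 1 < p) (hpr : p < r) (hr : r < 2)
    (f : Ω → ℝ) (hfM : Measurable[M] f) (hf : MemLp f (ENNReal.ofReal r) μ)
    (h₁ : ConvergesInLp (fun n => μ[birkhoffSum T f n | M])
      (ENNReal.ofReal (max 1 ((p - 1) * r / (r - 1)))) μ)
    (h₂ : ConvergesInLp (fun n => μ[birkhoffSum T f n | M] - μ[birkhoffSum T f n | M] ∘ T)
      (ENNReal.ofReal r) μ)
    (ε : ℝ) (hε : 0 < ε) (α : ℝ) (hα : α ∈ Set.Icc (1 / p) 1) :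
    ∑' n : ℕ+, ENNReal.ofReal ((n : ℝ) ^ (α * p - 2)) *
      μ {ω | ε * (n : ℝ) ^ α ≤ maxAbsPartialSum T f n ω} < ∞ := by
  have hr1 : 1 < r := hp.trans hpr
  have hα0 : 0 < α := lt_of_lt_of_le (by positivity) hα.1
  have hTM' : M ≤ M.comap T := le_comap_of_image hTM
  have hrE : 1 ≤ ENNReal.ofReal r := by simpa using hr1.le
  obtain ⟨g, hgM, hgq, hgr, h0⟩ := exists_transfer_function hT hM hTM (hf.integrable hrE)
    (by simp) hrE h₁ h₂
  have hgT : Measurable[M.comap T] (g ∘ T) := hgM.comp (comap_measurable _)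
  have hdm : Measurable[M.comap T] (f - (g - g ∘ T)) :=
    (hfM.mono hTM' le_rfl).sub ((hgM.mono hTM' le_rfl).sub hgT)
  have hmart := tsum_rpow_mul_measure_exists_birkhoffSum_ge_lt_top hT hM hTM' hr1 hpr hr hdm
    (hf.sub hgr) h0 (half_pos hε) hα0
  have hq0 : 0 < (p - 1) * r / (r - 1) :=
    div_pos (mul_pos (by linarith) (by linarith)) (by linarith)
  have hgq' : Integrable (fun ω => |g ω| ^ ((p - 1) * r / (r - 1))) μ := by
    have h := (hgq.mono_exponent (ENNReal.ofReal_le_ofReal (le_max_right _ _))).integrable_norm_rpow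
      (by simpa using hq0) ENNReal.ofReal_ne_top
    rwa [ENNReal.toReal_ofReal hq0.le] at h
  have hcob := tsum_rpow_mul_measure_exists_orbit_ge_lt_top hT hp hpr (hgM.mono hM le_rfl) hgq'
    (hgr.integrable_abs_rpow hr1) (by positivity : 0 < ε / 4) hα0 hα.2
  refine lt_of_le_of_lt ?_ (ENNReal.add_lt_top.2 ⟨hmart, hcob⟩)
  rw [← ENNReal.tsum_add]
  refine ENNReal.tsum_le_tsum fun n => ?_
  rw [← mul_add]
  refine mul_le_mul_right ((measure_mono fun ω hω => ?_).trans (measure_union_le _ _)) _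
  have hω' : ε * (n : ℝ) ^ α ≤ maxAbsPartialSum T f n ω := hω
  obtain ⟨k, hk, h⟩ := (Finset.le_sup'_iff _).1 hω'
  have hkn := (Finset.mem_Icc.1 hk).2
  rw [birkhoffSum_eq_add_coboundary T f g] at h
  by_cases c1 : ε / 2 * (n : ℝ) ^ α ≤ |birkhoffSum T (f - (g - g ∘ T)) k ω|
  · exact Or.inl ⟨k, hkn, c1⟩
  · -- otherwise `|g ω - g (T^[k] ω)|` exceeds `ε / 2 * n ^ α`
    by_cases c2 : ε / 4 * (n : ℝ) ^ α ≤ |g ω|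
    · exact Or.inr ⟨0, zero_le, c2⟩
    · refine Or.inr ⟨k, hkn, ?_⟩
      have t1 := abs_add_le (birkhoffSum T (f - (g - g ∘ T)) k ω) (g ω - g (T^[k] ω))
      have t2 := abs_sub (g ω) (g (T^[k] ω))
      linarith
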